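/- Let $(H_\lambda)_{\lambda}$ be a family of complex Hilbert spaces, let $K(H_\lambda)$ denote the C$^*$-algebra of compact operators on $H_\lambda$, and let $$A=\bigoplus_\lambda^{c_0}K(H_\lambda)=\Big\{(x_\lambda)\in\prod_\lambda K(H_\lambda):\ \lim_\lambda\|x_\lambda\|=0\Big\}$$ be the corresponding compact C$^*$-algebra (with pointwise operations and the supremum norm; $\lim_\lambda\|x_\lambda\|=0$ means that for every $\varepsilon>0$ one has $\|x_\lambda\|\ge\varepsilon$ for only finitely many $\lambda$), with coordinate projections $\pi_\lambda:A\to K(H_\lambda)$. For a complex Banach space $X$, a bounded bilinear map $V:A\times A\to X$ is said to have \emph{product property} if there is a bounded linear map $\varphi:A\to X$ such that $V(a,b)=\varphi(ab)$ for all $a,b\in A$; it has \emph{product property at $c\in A$} if there is a linear map $\varphi:A\to X$ such that $V(a,b)=\varphi(ab)$ for all $a,b\in A$ with $ab=c$. The algebra $A$ is \emph{determined by products at $c$} (as a Banach algebra) if, for every complex Banach space $X$, every bounded bilinear map $V:A\times A\to X$ that has product property at $c$ has product property. \textbf{Theorem.} Let $c\in A$ satisfy the rank hypothesis $$\mathrm{rank}(\pi_\lambda(c))\le\dim(H_\lambda)-2\quad\text{for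 all }\lambda,\tag{RH}$$ where ranks and dimensions are taken in $\mathbb N\cup\{\infty\}$ and the inequality is read as $\mathrm{rank}(\pi_\lambda(c))+2\le\dim(H_\lambda)$ (so it holds automatically whenever $\dim H_\lambda=\infty$). Then $A$ is determined (as a Banach algebra) by products at $c$. In particular, if no summand $K(H_\lambda)$ of $A$ is finite-dimensional, then $A$ is determined (as a Banach algebra) by products at every element of $A$. -/

import Mathlib

open Filter Topology
open scoped ENNReal

/-! ### Bilinear maps with product property -/

section ProductProperty

variable {A : Type*} [NonUnitalNormedRing A] [NormedSpace ℂ A]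
variable {X : Type*} [NormedAddCommGroup X] [NormedSpace ℂ X]

/-- A bounded bilinear map `V : A × A → X` has product property if `V (a, b) = φ (a b)` for all
`a, b`, for some bounded linear map `φ : A → X`. -/
def HasProductProperty (V : A →L[ℂ] A →L[ℂ] X) : Prop :=
  ∃ φ : A →L[ℂ] X, ∀ a b : A, V a b = φ (a * b)

/-- A bounded bilinear map `V : A × A → X` has product property at `c` if there is a linear map
`φ : A → X` (not required to be bounded) with `V (a, b) = φ (a b)` whenever `a b = c`. -/
def HasProductPropertyAt (V : A →L[ℂ] A →L[ℂ] X) (c : A) : Prop :=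
  ∃ φ : A →ₗ[ℂ] X, ∀ a b : A, a * b = c → V a b = φ (a * b)

end ProductProperty

universe u v w

/-- A Banach algebra `A` is determined (as a Banach algebra) by products at `c` if every bounded
bilinear map from `A × A` into a Banach space having product property at `c` has product
property. -/
def IsDeterminedByProductsAt (A : Type u) [NonUnitalNormedRing A] [NormedSpace ℂ A] (c : A) :
    Prop :=
  ∀ (X : Type w) [NormedAddCommGroup X] [NormedSpace ℂ X] [CompleteSpace X]
    (V : A →L[ℂ] A →L[ℂ] X), HasProductPropertyAt V c → HasProductProperty V

/-! ### The C⋆-algebra `K(H)` of compact operators -/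

section CompactOperators

variable (H : Type*) [NormedAddCommGroup H] [InnerProductSpace ℂ H] [CompleteSpace H]

variable {H} in
/-- The adjoint of a compact operator on a Hilbert space is compact. -/
theorem isCompactOperator_star {T : H →L[ℂ] H} (hT : IsCompactOperator T) :
    IsCompactOperator (star T : H →L[ℂ] H) := by
  have hS : IsCompactOperator (T * star T : H →L[ℂ] H) :=
    hT.comp_clm (star T : H →L[ℂ] H)
  have hS' : TotallyBounded ((T * star T : H →L[ℂ] H) '' Metric.closedBall (0 : H) 1) := by
    obtain ⟨K, hK, hsub⟩ :=
      IsCompactOperator.image_closedBall_subset_compact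
        (f := ((T * star T : H →L[ℂ] H) : H →ₗ[ℂ] H)) hS 1
    exact hK.totallyBounded.subset hsub
  have key : TotallyBounded ((star T : H →L[ℂ] H) '' Metric.closedBall (0 : H) 1) := by
    rw [Metric.totallyBounded_iff]
    intro ε hε
    obtain ⟨t, hts, htf, hcov⟩ := totallyBounded_iff_subset.1 hS' _
      (Metric.dist_mem_uniformity (show 0 < ε ^ 2 / 4 by positivity))
    obtain ⟨t', ht's, ht'f, rfl⟩ := Set.exists_subset_image_finite_and.1 ⟨t, hts, htf, rfl⟩
    refine ⟨(star T : H →L[ℂ] H) '' t', ht'f.image _, ?_⟩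
    rintro _ ⟨x, hx, rfl⟩
    have := hcov ⟨x, hx, rfl⟩
    simp only [Set.mem_iUnion, Set.mem_image] at this
    obtain ⟨_, ⟨y, hy, rfl⟩, hxy⟩ := this
    simp only [Set.mem_iUnion, Set.mem_image]
    refine ⟨_, ⟨y, hy, rfl⟩, ?_⟩
    have hxy' : ‖(T * star T : H →L[ℂ] H) (x - y)‖ < ε ^ 2 / 4 := by
      rw [map_sub, ← dist_eq_norm]; exact hxy
    rw [Metric.mem_ball, dist_eq_norm, ← map_sub]
    have h1 : ‖(star T : H →L[ℂ] H) (x - y)‖ ^ 2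
        ≤ ‖(T * star T : H →L[ℂ] H) (x - y)‖ * ‖x - y‖ := by
      rw [← inner_self_eq_norm_sq (𝕜 := ℂ)]
      nth_rewrite 1 [ContinuousLinearMap.star_eq_adjoint]
      rw [ContinuousLinearMap.adjoint_inner_left, mul_comm]
      refine (RCLike.re_le_norm _).trans (norm_inner_le_norm _ _)
    have h2 : ‖x - y‖ ≤ 2 := by
      have hx' : ‖x‖ ≤ 1 := by simpa using hx
      have hy' : ‖y‖ ≤ 1 := by simpa using ht's hy
      linarith [norm_sub_le x y]
    have h3 : ‖(star T : H →L[ℂ] H) (x - y)‖ ^ 2 < ε ^ 2 := by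
      nlinarith [norm_nonneg (x - y), norm_nonneg ((T * star T : H →L[ℂ] H) (x - y)),
        pow_pos hε 2]
    exact lt_of_pow_lt_pow_left₀ 2 hε.le h3
  exact (isCompactOperator_iff_isCompact_closure_image_closedBall
    ((star T : H →L[ℂ] H) : H →ₗ[ℂ] H) one_pos).2
    (key.closure.isCompact_of_isClosed isClosed_closure)

/-- `K(H)`, the C⋆-algebra of compact operators on the Hilbert space `H`. -/
def CompactOperators : NonUnitalStarSubalgebra ℂ (H →L[ℂ] H) where
  carrier := {T | IsCompactOperator T}
  add_mem' hS hT := hS.add hT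
  zero_mem' := isCompactOperator_zero
  mul_mem' {_ T} hS _ := IsCompactOperator.comp_clm hS T
  smul_mem' z _ hT := hT.smul z
  star_mem' hT := isCompactOperator_star hT

instance CompactOperators.isClosed :
    IsClosed ((CompactOperators H : NonUnitalStarSubalgebra ℂ (H →L[ℂ] H)) :
      Set (H →L[ℂ] H)) :=
  isClosed_setOfPred_isCompactOperator

end CompactOperators

/-! ### `c₀`-direct sums of C⋆-algebras -/

section C0Sum

variable {ι : Type*} (B : ι → Type*) [∀ i, NonUnitalCStarAlgebra (B i)]

/-- The `c₀`-direct sum of a family of C⋆-algebras: all families `x` with `‖x i‖ → 0` along the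
cofinite filter, inside the `ℓ^∞`-direct sum with pointwise operations and supremum norm. -/
noncomputable def C0Sum : NonUnitalStarSubalgebra ℂ (lp B ∞) where
  carrier := {x | Tendsto (fun i => ‖x i‖) cofinite (𝓝 0)}
  add_mem' {x y} hx hy := by
    refine squeeze_zero (fun i => norm_nonneg _) (fun i => norm_add_le (x i) (y i)) ?_
    simpa using Tendsto.add hx hy
  zero_mem' := by
    change Tendsto (fun i => ‖(0 : B i)‖) cofinite (𝓝 0)
    simpa only [norm_zero] using tendsto_const_nhds
  mul_mem' {x y} hx hy := by
    refine squeeze_zero (fun i => norm_nonneg _) (fun i => norm_mul_le (x i) (y i)) ?_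
    simpa using Tendsto.mul hx hy
  smul_mem' z x hx := by
    refine squeeze_zero (fun i => norm_nonneg _) (fun i => (norm_smul z (x i)).le) ?_
    simpa using Tendsto.const_mul ‖z‖ hx
  star_mem' {x} hx := by
    simpa using hx

instance C0Sum.isClosed :
    IsClosed ((C0Sum B : NonUnitalStarSubalgebra ℂ (lp B ∞)) : Set (lp B ∞)) := by
  refine isClosed_of_closure_subset fun x hx => ?_
  change Tendsto (fun i => ‖x i‖) cofinite (𝓝 0)
  rw [Metric.tendsto_nhds]
  intro ε hε
  obtain ⟨y, hy, hxy⟩ := Metric.mem_closure_iff.1 hx (ε / 2) (half_pos hε)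
  have hy' : Tendsto (fun i => ‖y i‖) cofinite (𝓝 0) := hy
  filter_upwards [Metric.tendsto_nhds.1 hy' (ε / 2) (half_pos hε)] with i hi
  have h1 : ‖x i - y i‖ ≤ ‖x - y‖ := lp.norm_apply_le_norm ENNReal.top_ne_zero (x - y) i
  have h2 : ‖x i‖ ≤ ‖x i - y i‖ + ‖y i‖ := by
    simpa using norm_add_le (x i - y i) (y i)
  rw [dist_eq_norm] at hxy
  simp only [dist_zero_right, norm_norm] at hi ⊢
  linarith

end C0Sum

/-! ### Compact C⋆-algebras and the rank hypothesis -/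

section CompactCStarAlgebra

variable {ι : Type u} (H : ι → Type v) [∀ i, NormedAddCommGroup (H i)]
  [∀ i, InnerProductSpace ℂ (H i)] [∀ i, CompleteSpace (H i)]

/-- The compact C⋆-algebra given by the `c₀`-direct sum of the algebras `K(H i)`. -/
abbrev CompactCStarAlgebra : Type (max u v) :=
  C0Sum (fun i => CompactOperators (H i))

variable {H}

/-- The `i`-th component `π i c` of `c`, as a bounded operator on `H i`. -/
noncomputable def CompactCStarAlgebra.component (c : CompactCStarAlgebra H) (i : ι) :
    H i →L[ℂ] H i :=
  ((c : lp (fun i => CompactOperators (H i)) ∞) i : CompactOperators (H i))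

/-- The rank hypothesis `rank (π i c) ≤ dim (H i) - 2` for all `i`. Rank and dimension lie in
`ℕ ∪ {∞}`; the inequality is written without subtraction, so `dim (H i) ≥ 2` is part of it, and
it always holds when `H i` is infinite-dimensional. -/
def RankHypothesis (c : CompactCStarAlgebra H) : Prop :=
  ∀ i, Cardinal.toENat (LinearMap.rank (c.component i : H i →ₗ[ℂ] H i)) + 2 ≤
    Cardinal.toENat (Module.rank ℂ (H i))

end CompactCStarAlgebra

/-!
Let `V` have product property at `c`. If `c = a * b`, and if `x * b = 0`, `a * y = 0` and
`x * y = 0`, then `c` is the product of each of the pairs `(a, b)`, `(a + x, b)`, `(a, b + y)` and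
`(a + x, b + y)`. Since `V` is constant on the pairs with product `c`, it follows that `V x y = 0`
(`HasProductPropertyAt.map_eq_zero`).

This applies to all rank-one elements `x = ξ ⊗ η⋆` and `y = ζ ⊗ θ⋆` with `x * y = 0`. What is needed
is a factorization `c = a * b` such that `a ζ = 0` and the range of `b` is orthogonal to `η`, and
this is where the rank hypothesis enters (`CompactOperators.exists_mul_eq`). On a finite-dimensional
`H i`, the component of `c` factors through the orthogonal complement of `η` and `ζ`, which has
dimension at least `dim (H i) - 2`. On an infinite-dimensional one, take any factorization
`a₀ * b₀` in `K(H i)` and an isometry `S` with range orthogonal to `η` and `ζ`; then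
`a = a₀ * S⋆` and `b = S * b₀` are as required. The components other than the two concerned only
need some factorization of `c` in the whole algebra. That every element of a C⋆-algebra is a
product of two elements is proved by functional calculus (`exists_mul_eq_of_nonUnitalCStarAlgebra`).

A sesquilinear map that vanishes on orthogonal pairs is a multiple of the inner product
(`inner_smul_comm_of_forall_inner_eq_zero`). Hence `V (a * b) p = V a (b * p)` for rank-one
elements `a`, `b`, `p`, and for all elements because rank-one elements span a dense subspace
(`map_mul_eq_of_rankOne`).

Finally, this identity makes `φ x = lim V x e`, along an approximate unit `e`, well defined: if
`x = a * b`, then `V (a * b) e = V a (b * e)` tends to `V a b`. So `V a b = φ (a * b)`, and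
`‖φ‖ ≤ ‖V‖` (`hasProductProperty_of_map_mul_eq`).
-/

/-! ### Factorization and approximate units in C⋆-algebras -/

section CStar

variable {A : Type*} [NonUnitalCStarAlgebra A]

/-- The functional calculus of `star c * c` controls the norm of `c * (g (star c * c) - r)`,
because `‖c (g - r)‖² = ‖(g - r) c⋆ c (g - r)‖`. -/
theorem norm_mul_cfcₙ_star_mul_self_sub_le (c : A) (r : ℝ) {g : ℝ → ℝ} (hg : Continuous g)
    (hg0 : g 0 = 0) {K : ℝ} (hK : 0 ≤ K) (h : ∀ t, 0 ≤ t → t * (g t - r) ^ 2 ≤ K ^ 2) :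
    ‖c * cfcₙ g (star c * c) - r • c‖ ≤ K := by
  have hgsa : star (cfcₙ g (star c * c)) = cfcₙ g (star c * c) :=
    (IsSelfAdjoint.cfcₙ (f := g)).star_eq
  refine le_of_sq_le_sq ?_ hK
  have hk : star (c * cfcₙ g (star c * c) - r • c) * (c * cfcₙ g (star c * c) - r • c)
      = cfcₙ (fun t => g t * (t * g t) - r * (g t * t) - (r * (t * g t) - r * (r * t)))
          (star c * c) := by
    rw [cfcₙ_sub (fun t => g t * (t * g t) - r * (g t * t)) (fun t => r * (t * g t) - r * (r * t)),
      cfcₙ_sub (fun t => g t * (t * g t)) (fun t => r * (g t * t)),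
      cfcₙ_sub (fun t => r * (t * g t)) (fun t => r * (r * t)),
      cfcₙ_const_mul r (fun t => g t * t), cfcₙ_const_mul r (fun t => t * g t),
      cfcₙ_const_mul r (fun t => r * t), cfcₙ_const_mul r (fun t => t),
      cfcₙ_mul g (fun t => t * g t) _, cfcₙ_mul (fun t => t) g _, cfcₙ_mul g (fun t => t) _,
      cfcₙ_id' ℝ (star c * c), star_sub, star_mul, star_smul, hgsa]
    simp only [mul_assoc, mul_sub, sub_mul, smul_mul_assoc, mul_smul_comm, star_trivial, smul_sub]
    abel
  rw [sq, ← CStarRing.norm_star_mul_self, hk]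
  refine norm_cfcₙ_le fun t ht => ?_
  have ht0 : 0 ≤ t := by
    let _ := CStarAlgebra.spectralOrder A
    let _ := CStarAlgebra.spectralOrderedRing A
    exact quasispectrum_nonneg_of_nonneg _ (star_mul_self_nonneg c) t ht
  have hts : g t * (t * g t) - r * (g t * t) - (r * (t * g t) - r * (r * t))
      = t * (g t - r) ^ 2 := by ring
  rw [hts, Real.norm_of_nonneg (mul_nonneg ht0 (sq_nonneg _))]
  exact h t ht0

/-- Every element of a C⋆-algebra is a product of two elements: with `h = (star c * c) ^ (1 / 4)`,
the sequence `c * (h * (h ^ 2 + ε ^ 2)⁻¹)` converges as `ε → 0`, and `c` is its limit times `h`. -/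
theorem exists_mul_eq_of_nonUnitalCStarAlgebra (c : A) : ∃ a b : A, a * b = c := by
  let s : ℝ → ℝ := fun t => √(√t)
  have hs : Continuous s := by fun_prop
  have hs0 : s 0 = 0 := by simp [s]
  have hsn (t : ℝ) : 0 ≤ s t := Real.sqrt_nonneg _
  have hs4 (t : ℝ) (ht : 0 ≤ t) : s t ^ 4 = t := by
    rw [show s t ^ 4 = (s t ^ 2) ^ 2 by ring, Real.sq_sqrt (Real.sqrt_nonneg _), Real.sq_sqrt ht]
  let ε : ℕ → ℝ := fun n => 1 / ((n : ℝ) + 1)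
  have hε (n : ℕ) : 0 < ε n := Nat.one_div_pos_of_nat
  have hεlim : Tendsto ε atTop (𝓝 0) := tendsto_one_div_add_atTop_nhds_zero_nat
  have hd (n : ℕ) (t : ℝ) : 0 < s t ^ 2 + ε n ^ 2 := by have := hε n; positivity
  let g : ℕ → ℝ → ℝ := fun n t => s t / (s t ^ 2 + ε n ^ 2)
  have hg (n : ℕ) : Continuous (g n) :=
    hs.div ((hs.pow 2).add continuous_const) fun t => (hd n t).ne'
  have hg0 (n : ℕ) : g n 0 = 0 := by simp [g, hs0]
  -- `s ^ 2 * g n` approximates `s` uniformly on the positive half-line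
  have hgs (n : ℕ) (t : ℝ) : |s t ^ 2 * g n t - s t| ≤ ε n := by
    have h1 : s t ^ 2 * g n t - s t = -(ε n * (s t * ε n / (s t ^ 2 + ε n ^ 2))) := by
      have := (hd n t).ne'
      simp only [g]
      field_simp
      ring
    have h2 : s t * ε n / (s t ^ 2 + ε n ^ 2) ≤ 1 := by
      rw [div_le_one (hd n t)]
      nlinarith [sq_nonneg (s t - ε n), sq_nonneg (s t), sq_nonneg (ε n)]
    have h3 : 0 ≤ s t * ε n / (s t ^ 2 + ε n ^ 2) :=
      div_nonneg (mul_nonneg (hsn t) (hε n).le) (hd n t).le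
    rw [h1, abs_neg, abs_of_nonneg (mul_nonneg (hε n).le h3)]
    exact mul_le_of_le_one_right (hε n).le h2
  let x : ℕ → A := fun n => c * cfcₙ (g n) (star c * c)
  have hdist (m n : ℕ) : dist (x m) (x n) ≤ ε m + ε n := by
    have h1 : x m - x n = c * cfcₙ (fun t => g m t - g n t) (star c * c) - (0 : ℝ) • c := by
      rw [cfcₙ_sub (g m) (g n) _ (hg m).continuousOn (hg0 m) (hg n).continuousOn (hg0 n)]
      simp only [x, mul_sub, zero_smul, sub_zero]
    rw [dist_eq_norm, h1]
    refine norm_mul_cfcₙ_star_mul_self_sub_le c 0 ((hg m).sub (hg n)) (by simp [hg0])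
      (add_pos (hε m) (hε n)).le fun t ht => ?_
    have h2 : t * (g m t - g n t - 0) ^ 2
        = ((s t ^ 2 * g m t - s t) - (s t ^ 2 * g n t - s t)) ^ 2 := by
      nth_rewrite 1 [← hs4 t ht]
      ring
    refine h2.trans_le ?_
    rw [sq_le_sq, abs_of_pos (add_pos (hε m) (hε n))]
    exact (abs_sub _ _).trans (add_le_add (hgs m t) (hgs n t))
  have hcau : CauchySeq x := by
    refine cauchySeq_of_le_tendsto_0 (fun n => ε n + ε n) (fun m n N hm hn => ?_)
      (by simpa using hεlim.add hεlim)
    refine (hdist m n).trans (add_le_add ?_ ?_)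
    · exact Nat.one_div_le_one_div hm
    · exact Nat.one_div_le_one_div hn
  obtain ⟨a, ha⟩ := cauchySeq_tendsto_of_complete hcau
  refine ⟨a, cfcₙ s (star c * c), tendsto_nhds_unique (ha.mul_const _) ?_⟩
  rw [tendsto_iff_norm_sub_tendsto_zero]
  refine squeeze_zero (fun n => norm_nonneg _) (fun n => ?_)
    (show Tendsto (fun n => ε n ^ 2) atTop (𝓝 0) by simpa using hεlim.pow 2)
  have h1 : x n * cfcₙ s (star c * c) - c
      = c * cfcₙ (fun t => g n t * s t) (star c * c) - (1 : ℝ) • c := by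
    rw [cfcₙ_mul (g n) s _ (hg n).continuousOn (hg0 n) hs.continuousOn hs0, one_smul, ← mul_assoc]
  rw [h1]
  refine norm_mul_cfcₙ_star_mul_self_sub_le c 1 ((hg n).mul hs) (by simp [hg0])
    (sq_nonneg _) fun t ht => ?_
  have h2 : t * (g n t * s t - 1) ^ 2 = (ε n ^ 2 * (s t ^ 2 / (s t ^ 2 + ε n ^ 2))) ^ 2 := by
    nth_rewrite 1 [← hs4 t ht]
    have := (hd n t).ne'
    simp only [g]
    field_simp
    ring
  refine h2.trans_le ?_
  have h3 : s t ^ 2 / (s t ^ 2 + ε n ^ 2) ≤ 1 := by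
    rw [div_le_one (hd n t)]
    linarith [sq_nonneg (ε n)]
  have h4 : 0 ≤ s t ^ 2 / (s t ^ 2 + ε n ^ 2) := div_nonneg (sq_nonneg _) (hd n t).le
  exact pow_le_pow_left₀ (mul_nonneg (sq_nonneg _) h4)
    (mul_le_of_le_one_right (sq_nonneg _) h3) 2

/-- A balanced bounded bilinear map on a C⋆-algebra has product property. The linear map is
`x ↦ lim V x e` along the canonical approximate unit; the limit exists at `x = a * b` because
`V (a * b) e = V a (b * e)`, and every `x` has this form. -/
theorem hasProductProperty_of_map_mul_eq {X : Type*} [NormedAddCommGroup X] [NormedSpace ℂ X]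
    (V : A →L[ℂ] A →L[ℂ] X) (hV : ∀ a b p, V (a * b) p = V a (b * p)) :
    HasProductProperty V := by
  let _ := CStarAlgebra.spectralOrder A
  let _ := CStarAlgebra.spectralOrderedRing A
  have hl := CStarAlgebra.increasingApproximateUnit A
  set l := CStarAlgebra.approximateUnit A
  have : l.NeBot := hl.neBot
  have hlim (a b : A) : Tendsto (fun e => V (a * b) e) l (𝓝 (V a b)) := by
    simp only [hV]
    exact ((V a).continuous.tendsto b).comp (hl.tendsto_mul_left b)
  have hex (x : A) : ∃ y, Tendsto (fun e => V x e) l (𝓝 y) := by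
    obtain ⟨a, b, rfl⟩ := exists_mul_eq_of_nonUnitalCStarAlgebra x
    exact ⟨_, hlim a b⟩
  choose f hf using hex
  let φ : A →ₗ[ℂ] X :=
    { toFun := f
      map_add' := fun x y => tendsto_nhds_unique (hf (x + y)) (by
        simpa only [map_add, add_apply] using (hf x).add (hf y))
      map_smul' := fun r x => tendsto_nhds_unique (hf (r • x)) (by
        simpa only [map_smul, smul_apply, RingHom.id_apply] using (hf x).const_smul r) }
  refine ⟨φ.mkContinuous ‖V‖ fun x => ?_, fun a b => ?_⟩
  · refine le_of_tendsto (hf x).norm ?_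
    filter_upwards [hl.eventually_norm] with e he
    refine (V.le_opNorm₂ x e).trans ?_
    exact mul_le_of_le_one_right (by positivity) he
  · exact tendsto_nhds_unique (hlim a b) (hf (a * b))

end CStar

/-! ### Sesquilinear maps vanishing on orthogonal pairs -/

/-- A sesquilinear map vanishing on orthogonal pairs is a multiple of the inner product, in the
form of an identity that avoids naming the multiple. -/
theorem inner_smul_comm_of_forall_inner_eq_zero {E X : Type*} [NormedAddCommGroup E]
    [InnerProductSpace ℂ E] [AddCommGroup X] [Module ℂ X] (B : E →ₗ⋆[ℂ] E →ₗ[ℂ] X)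
    (hB : ∀ η ζ, inner ℂ η ζ = 0 → B η ζ = 0) (η ζ θ κ : E) :
    inner ℂ θ κ • B η ζ = inner ℂ η ζ • B θ κ := by
  have key (u η ζ : E) (hu : u ≠ 0) : inner ℂ u u • B η ζ = inner ℂ η ζ • B u u := by
    have hN : inner ℂ u u ≠ (0 : ℂ) := inner_self_ne_zero.2 hu
    -- `N η` and `N ζ` are split into multiples of `u` and parts `η'`, `ζ'` orthogonal to `u`
    obtain ⟨N, hNdef⟩ : ∃ N : ℂ, inner ℂ u u = N := ⟨_, rfl⟩
    have hNc : (starRingEnd ℂ) N = N := by rw [← hNdef]; exact inner_self_conj u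
    rw [hNdef] at hN ⊢
    let η' := N • η - inner ℂ u η • u
    let ζ' := N • ζ - inner ℂ u ζ • u
    have h1 : inner ℂ η' u = 0 := by
      simp only [η', inner_sub_left, inner_smul_left, hNdef, hNc, inner_conj_symm]; ring
    have h2 : inner ℂ u ζ' = 0 := by
      simp only [ζ', inner_sub_right, inner_smul_right, hNdef]; ring
    have h3 : inner ℂ η' ζ' = N * (N * inner ℂ η ζ - inner ℂ η u * inner ℂ u ζ) := by
      simp only [η', ζ', inner_sub_right, inner_smul_right, inner_sub_left, inner_smul_left,
        hNdef, hNc, inner_conj_symm]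
      ring
    have h4 : B (u + η') (-inner ℂ η' ζ' • u + N • ζ') = 0 := by
      refine hB _ _ ?_
      simp only [inner_add_left, inner_add_right, inner_smul_right, hNdef, h1, h2]
      ring
    simp only [map_add, LinearMap.add_apply, map_smul, hB _ _ h1, hB _ _ h2, add_zero,
      zero_add] at h4
    have h5 : B η' ζ' = (N * N) • B η ζ - (inner ℂ η u * inner ℂ u ζ) • B u u := by
      have h6 : B (N • η) (N • ζ) = B (η' + inner ℂ u η • u) (ζ' + inner ℂ u ζ • u) := by
        simp only [η', ζ', sub_add_cancel]
      simp only [map_add, LinearMap.add_apply, map_smul, map_smulₛₗ, LinearMap.smul_apply,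
        hB _ _ h1, hB _ _ h2, smul_zero, add_zero, zero_add, smul_smul, hNc,
        inner_conj_symm] at h6
      rw [h6]
      module
    rw [h5, h3] at h4
    have h7 : (N * N) • (N • B η ζ - inner ℂ η ζ • B u u) = 0 := by
      rw [← h4]
      module
    exact sub_eq_zero.1 ((smul_eq_zero.1 h7).resolve_left (mul_ne_zero hN hN))
  by_cases hθ : θ = 0
  · simp [hθ]
  have hN : inner ℂ θ θ ≠ (0 : ℂ) := inner_self_ne_zero.2 hθ
  refine smul_right_injective X hN ?_
  change inner ℂ θ θ • inner ℂ θ κ • B η ζ = inner ℂ θ θ • inner ℂ η ζ • B θ κ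
  rw [smul_comm (inner ℂ θ θ) (inner ℂ θ κ), key θ η ζ hθ, smul_comm (inner ℂ θ θ) (inner ℂ η ζ),
    key θ θ κ hθ, smul_comm]

/-! ### Factorization of compact operators avoiding prescribed vectors -/

section Local

variable {H : Type*} [NormedAddCommGroup H] [InnerProductSpace ℂ H]

/-- An infinite-dimensional Hilbert space has a linear isometry whose range is orthogonal to a given
finite-dimensional subspace: shift a Hilbert basis extending an orthonormal basis of the
subspace. -/
theorem exists_linearIsometry_range_le_orthogonal [CompleteSpace H]
    (hH : ¬ FiniteDimensional ℂ H) (F : Submodule ℂ H) [FiniteDimensional ℂ F] :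
    ∃ S : H →ₗᵢ[ℂ] H, ∀ x, S x ∈ Fᗮ := by
  let u : Set H := Set.range fun k => (stdOrthonormalBasis ℂ F k : H)
  have hufin : u.Finite := Set.finite_range _
  have hon : Orthonormal ℂ fun k => (stdOrthonormalBasis ℂ F k : H) :=
    (stdOrthonormalBasis ℂ F).orthonormal.comp_linearIsometry F.subtypeₗᵢ
  have hu : Orthonormal ℂ ((↑) : u → H) := hon.toSubtypeRange
  have hspan : Submodule.span ℂ u = F := by
    have h1 := congrArg (Submodule.map F.subtype) (stdOrthonormalBasis ℂ F).toBasis.span_eq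
    rw [Submodule.map_span, Submodule.map_top, Submodule.range_subtype, ← Set.range_comp] at h1
    simpa [u, Function.comp_def] using h1
  obtain ⟨w, b, huw, hb⟩ := hu.exists_hilbertBasis_extension
  have hw : Infinite w := by
    refine not_finite_iff_infinite.1 fun hfin => hH ?_
    have : Fintype w := Fintype.ofFinite w
    exact b.toOrthonormalBasis.toBasis.finiteDimensional_of_finite
  -- the index set without the finitely many basis vectors in `F` still has full cardinality
  let t : Set w := {k | (k : H) ∈ u}
  have ht : t.Finite := hufin.preimage Subtype.val_injective.injOn
  obtain ⟨e⟩ := Cardinal.eq.1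
    (Cardinal.mk_compl_of_infinite t (ht.lt_aleph0.trans_le (Cardinal.aleph0_le_mk w))).symm
  have hort : Orthonormal ℂ ((↑) : w → H) := hb ▸ b.orthonormal
  have hv : Orthonormal ℂ fun k : w => ((e k : w) : H) :=
    hort.comp (fun k => (e k : w)) (Subtype.val_injective.comp e.injective)
  refine ⟨hv.orthogonalFamily.linearIsometry.comp b.repr.toLinearIsometry, fun x => ?_⟩
  have hsum := hv.orthogonalFamily.hasSum_linearIsometry (b.repr x)
  refine (Submodule.isClosed_orthogonal F).mem_of_tendsto hsum (Eventually.of_forall fun s => ?_)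
  refine Submodule.sum_mem _ fun k _ => ?_
  simp only [LinearIsometry.toSpanSingleton_apply]
  refine Submodule.smul_mem _ _ ?_
  rw [← hspan]
  refine (Submodule.isOrtho_span (s := {((e k : w) : H)}).2 ?_)
    (Submodule.subset_span (Set.mem_singleton _))
  rintro _ rfl y ⟨l, rfl⟩
  -- `y` is a basis vector too, because `u ⊆ w`, and it differs from the one indexed by `e k`
  have hne : (⟨_, huw ⟨l, rfl⟩⟩ : w) ≠ e k := fun h => (e k).2 (h ▸ ⟨l, rfl⟩)
  exact hort.2 hne.symm

/-- In finite dimension, an operator `T` factors through the orthogonal complement of any subspace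
of dimension at most `dim H - rank T`, in such a way that the left factor vanishes on the
subspace. -/
theorem exists_factorization_through_orthogonal [FiniteDimensional ℂ H] (T : H →ₗ[ℂ] H)
    (F : Submodule ℂ H) (hF : Module.finrank ℂ T.range + Module.finrank ℂ F ≤ Module.finrank ℂ H) :
    ∃ a b : H →ₗ[ℂ] H, a ∘ₗ b = T ∧ (∀ x ∈ F, a x = 0) ∧ ∀ x, b x ∈ Fᗮ := by
  have h1 : Module.finrank ℂ T.range ≤ Module.finrank ℂ Fᗮ := by
    have := F.finrank_add_finrank_orthogonal
    omega
  obtain ⟨f, hf⟩ := finrank_le_iff_exists_linearMap.1 h1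
  obtain ⟨g, hg⟩ := f.exists_leftInverse_of_injective (LinearMap.ker_eq_bot.2 hf)
  refine ⟨T.range.subtype ∘ₗ g ∘ₗ Fᗮ.orthogonalProjectionOnto.toLinearMap,
    Fᗮ.subtype ∘ₗ f ∘ₗ T.rangeRestrict, ?_, fun x hx => ?_, fun x => Subtype.prop _⟩
  · ext x
    have h2 : g (f (T.rangeRestrict x)) = T.rangeRestrict x := LinearMap.congr_fun hg _
    simp [h2]
  · have h2 : Fᗮ.orthogonalProjectionOnto x = 0 :=
      Submodule.orthogonalProjectionOnto_apply_of_mem_orthogonal (F.le_orthogonal_orthogonal hx)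
    simp [h2]

/-- A compact operator `T` with `rank T ≤ dim H - 2` is a product of compact operators `a` and `b`
such that `a` kills a given vector and the range of `b` is orthogonal to another one; the latter is
expressed by the adjoint of `b`. -/
theorem CompactOperators.exists_mul_eq [CompleteSpace H] (T : CompactOperators H)
    (hrank : Cardinal.toENat (LinearMap.rank ((T : H →L[ℂ] H) : H →ₗ[ℂ] H)) + 2 ≤
      Cardinal.toENat (Module.rank ℂ H)) (η ζ : H) :
    ∃ a b : CompactOperators H, a * b = T ∧ (a : H →L[ℂ] H) ζ = 0 ∧
      ContinuousLinearMap.adjoint (b : H →L[ℂ] H) η = 0 := by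
  let F : Submodule ℂ H := Submodule.span ℂ {η, ζ}
  have : FiniteDimensional ℂ F := FiniteDimensional.span_of_finite ℂ (Set.toFinite _)
  have hη : η ∈ F := Submodule.subset_span (by simp)
  have hζ : ζ ∈ F := Submodule.subset_span (by simp)
  have hadj (S : H →L[ℂ] H) (hS : ∀ x, S x ∈ Fᗮ) (ξ : H) (hξ : ξ ∈ F) :
      ContinuousLinearMap.adjoint S ξ = 0 := by
    refine ext_inner_right ℂ fun x => ?_
    rw [ContinuousLinearMap.adjoint_inner_left, inner_zero_left]
    exact hS x ξ hξ
  by_cases hH : FiniteDimensional ℂ H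
  · have hF : Module.finrank ℂ F ≤ 2 := by
      classical
      exact (finrank_span_le_card _).trans (by simpa using Finset.card_le_two)
    have hr : Module.finrank ℂ ((T : H →L[ℂ] H) : H →ₗ[ℂ] H).range + 2 ≤ Module.finrank ℂ H := by
      rw [LinearMap.rank, ← Module.finrank_eq_rank, ← Module.finrank_eq_rank] at hrank
      simp only [map_natCast] at hrank
      exact_mod_cast hrank
    obtain ⟨a, b, hab, ha, hb⟩ := exists_factorization_through_orthogonal _ F
      ((Nat.add_le_add_left hF _).trans hr)
    have := FiniteDimensional.proper ℂ H
    have hcomp (S : H →L[ℂ] H) : S ∈ CompactOperators H :=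
      isCompactOperator_of_locallyCompactSpace_dom S
    refine ⟨⟨a.toContinuousLinearMap, hcomp _⟩, ⟨b.toContinuousLinearMap, hcomp _⟩,
      Subtype.ext (ContinuousLinearMap.ext fun x => LinearMap.congr_fun hab x), ha ζ hζ,
      hadj b.toContinuousLinearMap hb η hη⟩
  · obtain ⟨S, hS⟩ := exists_linearIsometry_range_le_orthogonal hH F
    obtain ⟨a, b, hab⟩ := exists_mul_eq_of_nonUnitalCStarAlgebra T
    let S' : H →L[ℂ] H := S.toContinuousLinearMap
    have hS' : ContinuousLinearMap.adjoint S' * S' = 1 := S.adjoint_comp_self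
    have ha : IsCompactOperator ((a : H →L[ℂ] H) * ContinuousLinearMap.adjoint S') :=
      IsCompactOperator.comp_clm a.2 _
    have hb : IsCompactOperator (S' * (b : H →L[ℂ] H)) := IsCompactOperator.clm_comp b.2 _
    refine ⟨⟨_, ha⟩, ⟨_, hb⟩, Subtype.ext ?_, ?_, ?_⟩
    · change (a : H →L[ℂ] H) * ContinuousLinearMap.adjoint S' * (S' * b) = T
      rw [← hab, mul_assoc, ← mul_assoc _ S', hS', one_mul]
      rfl
    · change (a : H →L[ℂ] H) (ContinuousLinearMap.adjoint S' ζ) = 0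
      rw [hadj S' hS ζ hζ, map_zero]
    · change ContinuousLinearMap.adjoint (S' ∘L (b : H →L[ℂ] H)) η = 0
      rw [ContinuousLinearMap.adjoint_comp, ContinuousLinearMap.comp_apply, hadj S' hS η hη,
        map_zero]

/-- Finite-rank operators are dense among the compact operators: project onto the span of a finite
net of the image of the unit ball. -/
theorem IsCompactOperator.exists_norm_sub_sum_rankOne_le [CompleteSpace H]
    {T : H →L[ℂ] H} (hT : IsCompactOperator T) {ε : ℝ} (hε : 0 < ε) :
    ∃ (n : ℕ) (x y : Fin n → H), ‖T - ∑ k, InnerProductSpace.rankOne ℂ (x k) (y k)‖ ≤ ε := by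
  have htb : TotallyBounded (T '' Metric.closedBall (0 : H) 1) := by
    obtain ⟨K, hK, hsub⟩ := IsCompactOperator.image_closedBall_subset_compact
      (f := (T : H →ₗ[ℂ] H)) hT 1
    exact hK.totallyBounded.subset hsub
  obtain ⟨t, htfin, hcov⟩ := Metric.totallyBounded_iff.1 htb ε hε
  let F : Submodule ℂ H := Submodule.span ℂ t
  have : FiniteDimensional ℂ F := FiniteDimensional.span_of_finite ℂ htfin
  let e := stdOrthonormalBasis ℂ F
  refine ⟨_, fun k => (e k : H), fun k => ContinuousLinearMap.adjoint T (e k), ?_⟩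
  have hsum (x : H) : (∑ k, InnerProductSpace.rankOne ℂ (e k : H)
      (ContinuousLinearMap.adjoint T (e k))) x = F.starProjection (T x) := by
    rw [e.starProjection_eq_sum_rankOne]
    simp only [sum_apply, InnerProductSpace.rankOne_apply, ContinuousLinearMap.adjoint_inner_left]
  refine ContinuousLinearMap.opNorm_le_of_unit_norm hε.le fun x hx => ?_
  rw [sub_apply, hsum]
  have h1 := hcov ⟨x, by simp [hx], rfl⟩
  simp only [Set.mem_iUnion] at h1
  obtain ⟨y, hy, hxy⟩ := h1
  rw [Metric.mem_ball, dist_eq_norm] at hxy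
  refine le_trans ?_ hxy.le
  rw [Submodule.starProjection_minimal]
  exact ciInf_le ⟨0, by rintro _ ⟨z, rfl⟩; exact norm_nonneg _⟩ (⟨y, Submodule.subset_span hy⟩ : F)

end Local

/-! ### Summands of a `c₀`-direct sum -/

namespace C0Sum

variable {ι : Type*} {B : ι → Type*} [∀ i, NonUnitalCStarAlgebra (B i)]

theorem ext {a b : C0Sum B} (h : ∀ i, (a : lp B ∞) i = (b : lp B ∞) i) : a = b :=
  Subtype.ext (lp.ext (funext h))

theorem mul_apply (a b : C0Sum B) (i : ι) :
    ((a * b : C0Sum B) : lp B ∞) i = (a : lp B ∞) i * (b : lp B ∞) i := rfl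

theorem add_apply (a b : C0Sum B) (i : ι) :
    ((a + b : C0Sum B) : lp B ∞) i = (a : lp B ∞) i + (b : lp B ∞) i := rfl

/-- Evaluation at an index. -/
def eval (i : ι) : C0Sum B →+ B i where
  toFun a := (a : lp B ∞) i
  map_zero' := rfl
  map_add' _ _ := rfl

open Classical in
/-- The embedding of the `i`-th summand into a `c₀`-direct sum. -/
noncomputable def single (i : ι) : B i →ₗ[ℂ] C0Sum B where
  toFun T := ⟨lp.single ∞ i T, by
    change Tendsto (fun j => ‖lp.single ∞ i T j‖) cofinite (𝓝 0)
    refine tendsto_const_nhds.congr' ?_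
    filter_upwards [(Set.finite_singleton i).compl_mem_cofinite] with j hj
    rw [lp.single_apply_ne _ _ _ hj, norm_zero]⟩
  map_add' S T := Subtype.ext (lp.single_add ∞ i S T)
  map_smul' r T := Subtype.ext (lp.single_smul ∞ i r T)

theorem single_apply_same (i : ι) (T : B i) : (single i T : lp B ∞) i = T := by
  classical
  exact lp.single_apply_self ∞ i T

theorem single_apply_of_ne {i j : ι} (h : j ≠ i) (T : B i) : (single i T : lp B ∞) j = 0 := by
  classical
  exact lp.single_apply_ne ∞ i T h

theorem norm_single (i : ι) (T : B i) : ‖single i T‖ = ‖T‖ := by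
  classical
  exact lp.norm_single (by simp) i T

theorem mul_single (a : C0Sum B) (i : ι) (T : B i) :
    a * single i T = single i ((a : lp B ∞) i * T) := by
  refine ext fun j => ?_
  rw [mul_apply]
  by_cases h : j = i
  · subst h
    rw [single_apply_same, single_apply_same]
  · rw [single_apply_of_ne h, single_apply_of_ne h, mul_zero]

theorem single_mul (a : C0Sum B) (i : ι) (T : B i) :
    single i T * a = single i (T * (a : lp B ∞) i) := by
  refine ext fun j => ?_
  rw [mul_apply]
  by_cases h : j = i
  · subst h
    rw [single_apply_same, single_apply_same]
  · rw [single_apply_of_ne h, single_apply_of_ne h, zero_mul]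

/-- A closed subspace containing all summands is everything. -/
theorem mem_of_forall_single_mem {D : Submodule ℂ (C0Sum B)} (hD : IsClosed (D : Set (C0Sum B)))
    (h : ∀ i T, single i T ∈ D) (x : C0Sum B) : x ∈ D := by
  have hcl : x ∈ closure (D : Set (C0Sum B)) := by
    refine Metric.mem_closure_iff.2 fun ε hε => ?_
    have hx : Tendsto (fun i => ‖(x : lp B ∞) i‖) cofinite (𝓝 0) := x.2
    have hfin : {i | ¬ ‖(x : lp B ∞) i‖ < ε / 2}.Finite :=
      hx.eventually (gt_mem_nhds (half_pos hε))
    refine ⟨∑ i ∈ hfin.toFinset, single i ((x : lp B ∞) i), Submodule.sum_mem _ fun i _ => h i _,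
      ?_⟩
    rw [dist_eq_norm]
    refine lt_of_le_of_lt ?_ (half_lt_self hε)
    refine lp.norm_le_of_forall_le (half_pos hε).le fun i => ?_
    change ‖eval i (x - ∑ i ∈ hfin.toFinset, single i ((x : lp B ∞) i))‖ ≤ ε / 2
    rw [map_sub, map_sum]
    by_cases hi : i ∈ hfin.toFinset
    · rw [Finset.sum_eq_single_of_mem i hi fun j _ hj => single_apply_of_ne hj.symm _]
      change ‖(x : lp B ∞) i - (single i ((x : lp B ∞) i) : lp B ∞) i‖ ≤ ε / 2
      rw [single_apply_same, sub_self, norm_zero]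
      exact (half_pos hε).le
    · rw [Finset.sum_eq_zero fun j hj => single_apply_of_ne (ne_of_mem_of_not_mem hj hi).symm _,
        sub_zero]
      exact (not_not.1 fun hlt => hi (hfin.mem_toFinset.2 hlt)).le
  rwa [hD.closure_eq] at hcl

/-- A factorization can be changed in a single component. -/
theorem exists_mul_eq_of_apply_mul_eq {a b c : C0Sum B} (hab : a * b = c) (i : ι)
    {S T : B i} (hST : S * T = (c : lp B ∞) i) :
    ∃ a' b' : C0Sum B, a' * b' = c ∧ (a' : lp B ∞) i = S ∧ (b' : lp B ∞) i = T ∧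
      ∀ j ≠ i, (a' : lp B ∞) j = (a : lp B ∞) j ∧ (b' : lp B ∞) j = (b : lp B ∞) j := by
  let R (d : C0Sum B) (U : B i) : C0Sum B := d + single i (U - (d : lp B ∞) i)
  have hsame (d) (U) : (R d U : lp B ∞) i = U := by
    rw [add_apply, single_apply_same, add_sub_cancel]
  have hne (d) (U) (j) (hj : j ≠ i) : (R d U : lp B ∞) j = (d : lp B ∞) j := by
    rw [add_apply, single_apply_of_ne hj, add_zero]
  refine ⟨R a S, R b T, ext fun j => ?_, hsame a S, hsame b T,
    fun j hj => ⟨hne a S j hj, hne b T j hj⟩⟩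
  rw [mul_apply]
  by_cases h : j = i
  · subst h
    rw [hsame, hsame, hST]
  · rw [hne a S j h, hne b T j h, ← mul_apply, hab]

end C0Sum

/-! ### Rank-one operators -/

namespace CompactOperators

variable {E : Type*} [NormedAddCommGroup E] [InnerProductSpace ℂ E]

theorem isCompactOperator_rankOne (ξ η : E) :
    IsCompactOperator (InnerProductSpace.rankOne ℂ ξ η : E →L[ℂ] E) :=
  (isCompactOperator_of_locallyCompactSpace_rng
    (ContinuousLinearMap.toSpanSingleton ℂ ξ)).comp_clm (innerSL ℂ η)

variable [CompleteSpace E]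

variable (E) in
/-- The rank-one operator `ξ ⊗ η⋆ : ζ ↦ ⟪η, ζ⟫ ξ` as an element of `K(E)`, linear in `ξ` and
conjugate-linear in `η`. -/
noncomputable def rankOne : E →ₗ[ℂ] E →ₗ⋆[ℂ] CompactOperators E :=
  LinearMap.mk₂'ₛₗ (RingHom.id ℂ) (starRingEnd ℂ)
    (fun ξ η => ⟨InnerProductSpace.rankOne ℂ ξ η, isCompactOperator_rankOne ξ η⟩)
    (fun ξ ξ' η => Subtype.ext (by simp))
    (fun r ξ η => Subtype.ext (by simp))
    (fun ξ η η' => Subtype.ext (by simp))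
    (fun r ξ η => Subtype.ext (by simp))

theorem mul_rankOne (T : CompactOperators E) (ξ η : E) :
    T * rankOne E ξ η = rankOne E ((T : E →L[ℂ] E) ξ) η :=
  Subtype.ext (InnerProductSpace.comp_rankOne ξ η (T : E →L[ℂ] E))

theorem rankOne_mul (T : CompactOperators E) (ξ η : E) :
    rankOne E ξ η * T = rankOne E ξ (ContinuousLinearMap.adjoint (T : E →L[ℂ] E) η) := by
  refine Subtype.ext (ContinuousLinearMap.ext fun x => ?_)
  change inner ℂ η ((T : E →L[ℂ] E) x) • ξ
    = inner ℂ (ContinuousLinearMap.adjoint (T : E →L[ℂ] E) η) x • ξ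
  rw [ContinuousLinearMap.adjoint_inner_left]

theorem rankOne_mul_rankOne (ξ η ζ θ : E) :
    rankOne E ξ η * rankOne E ζ θ = inner ℂ η ζ • rankOne E ξ θ :=
  Subtype.ext (InnerProductSpace.rankOne_comp_rankOne ξ η ζ θ)

/-- A closed subspace containing all rank-one operators is everything. -/
theorem mem_of_forall_rankOne_mem {D : Submodule ℂ (CompactOperators E)}
    (hD : IsClosed (D : Set (CompactOperators E))) (h : ∀ ξ η, rankOne E ξ η ∈ D)
    (T : CompactOperators E) : T ∈ D := by
  have hcl : T ∈ closure (D : Set (CompactOperators E)) := by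
    refine Metric.mem_closure_iff.2 fun ε hε => ?_
    obtain ⟨n, x, y, hxy⟩ := IsCompactOperator.exists_norm_sub_sum_rankOne_le
      (T := (T : E →L[ℂ] E)) T.2 (half_pos hε)
    refine ⟨∑ k, rankOne E (x k) (y k), Submodule.sum_mem _ fun k _ => h _ _, ?_⟩
    rw [dist_eq_norm]
    refine lt_of_le_of_lt (le_trans (le_of_eq ?_) hxy) (half_lt_self hε)
    have h1 : ((∑ k, rankOne E (x k) (y k) : CompactOperators E) : E →L[ℂ] E)
        = ∑ k, InnerProductSpace.rankOne ℂ (x k) (y k) :=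
      map_sum (NonUnitalStarSubalgebraClass.subtype (CompactOperators E)) _ _
    change ‖(T : E →L[ℂ] E) - ((∑ k, rankOne E (x k) (y k) : CompactOperators E) : E →L[ℂ] E)‖ = _
    rw [h1]
  rwa [hD.closure_eq] at hcl

end CompactOperators

/-! ### Bilinear maps with product property at an element -/

section Bilinear

variable {A : Type*} [NonUnitalNormedRing A] [NormedSpace ℂ A]
  {X : Type*} [NormedAddCommGroup X] [NormedSpace ℂ X] {V : A →L[ℂ] A →L[ℂ] X}

/-- If `c = a * b`, `x * b = 0`, `a * y = 0` and `x * y = 0`, then `c` is also equal to the products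
`(a + x) * b`, `a * (b + y)` and `(a + x) * (b + y)`. A bilinear map with product property at `c`
takes the same value on these four pairs, so it vanishes at `(x, y)`. -/
theorem HasProductPropertyAt.map_eq_zero {c : A} (hV : HasProductPropertyAt V c) {a b x y : A}
    (hab : a * b = c) (hxb : x * b = 0) (hay : a * y = 0) (hxy : x * y = 0) : V x y = 0 := by
  obtain ⟨φ, hφ⟩ := hV
  have hφ' (a b : A) (hab : a * b = c) : V a b = φ c := by rw [hφ a b hab, hab]
  have h1 := hφ' a b hab
  have h2 := hφ' (a + x) b (by rw [add_mul, hxb, hab, add_zero])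
  have h3 := hφ' a (b + y) (by rw [mul_add, hay, hab, add_zero])
  have h4 := hφ' (a + x) (b + y) (by
    rw [add_mul, mul_add, mul_add, hxb, hay, hab, hxy, add_zero, add_zero, add_zero])
  simp only [map_add, add_apply] at h2 h3 h4
  rw [h1] at h2 h3 h4
  rw [add_eq_left.1 h2, add_eq_left.1 h3, add_zero, zero_add, add_eq_left] at h4
  exact h4

/-- Let `A` be topologically spanned by elements `R i ξ η` that multiply like the rank-one operators
`ξ ⊗ η⋆` on a family of mutually annihilating summands. A bounded bilinear map on `A` is balanced if
it vanishes on all pairs of such elements with zero product. -/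
theorem map_mul_eq_of_rankOne [IsScalarTower ℂ A A] [SMulCommClass ℂ A A]
    {ι : Type*} {H : ι → Type*} [∀ i, NormedAddCommGroup (H i)] [∀ i, InnerProductSpace ℂ (H i)]
    (R : ∀ i, H i →ₗ[ℂ] H i →ₗ⋆[ℂ] A)
    (hsame : ∀ i ξ η ζ θ, R i ξ η * R i ζ θ = inner ℂ η ζ • R i ξ θ)
    (hne : ∀ i j, i ≠ j → ∀ ξ η ζ θ, R i ξ η * R j ζ θ = 0)
    (hdense : ∀ D : Submodule ℂ A, IsClosed (D : Set A) → (∀ i ξ η, R i ξ η ∈ D) → D = ⊤)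
    (hzero : ∀ i j ξ η ζ θ, R i ξ η * R j ζ θ = 0 → V (R i ξ η) (R j ζ θ) = 0) (a b p : A) :
    V (a * b) p = V a (b * p) := by
  have hrank (i j k) (ξ η : H i) (ζ θ : H j) (κ μ : H k) :
      V (R i ξ η * R j ζ θ) (R k κ μ) = V (R i ξ η) (R j ζ θ * R k κ μ) := by
    by_cases hij : i = j
    · subst hij
      rw [hsame, map_smul, smul_apply]
      by_cases hik : i = k
      · subst hik
        rw [hsame, map_smul]
        -- the dependence on the two inner vectors of a product of rank-one elements
        let B : H i →ₗ⋆[ℂ] H i →ₗ[ℂ] X := LinearMap.mk₂'ₛₗ (starRingEnd ℂ) (RingHom.id ℂ)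
          (fun η ζ => V (R i ξ η) (R i ζ μ))
          (fun _ _ _ => by rw [map_add, map_add, add_apply])
          (fun _ _ _ => by rw [map_smulₛₗ, map_smul, smul_apply])
          (fun _ _ _ => by rw [map_add, LinearMap.add_apply, map_add])
          (fun _ _ _ => by rw [map_smul, LinearMap.smul_apply, map_smul, RingHom.id_apply])
        refine inner_smul_comm_of_forall_inner_eq_zero B (fun η ζ h => ?_) θ κ η ζ
        exact hzero _ _ _ _ _ _ (by rw [hsame, h, zero_smul])
      · rw [hne i k hik, map_zero, hzero _ _ _ _ _ _ (hne i k hik _ _ _ _), smul_zero]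
    · rw [hne i j hij, map_zero, zero_apply]
      by_cases hjk : j = k
      · subst hjk
        rw [hsame, map_smul, hzero _ _ _ _ _ _ (hne i j hij _ _ _ _), smul_zero]
      · rw [hne j k hjk, map_zero]
  -- extend from rank-one elements to all elements, one variable at a time
  have hext (f g : A →L[ℂ] X) (h : ∀ i ξ η, f (R i ξ η) = g (R i ξ η)) : f = g := by
    have h1 := hdense (f.toLinearMap.eqLocus g.toLinearMap)
      (isClosed_eq f.continuous g.continuous) h
    exact ContinuousLinearMap.ext fun x => (h1 ▸ Submodule.mem_top : x ∈ f.toLinearMap.eqLocus _)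
  let m := ContinuousLinearMap.mul ℂ A
  have h1 (i ξ η j ζ θ) : V (R i ξ η * R j ζ θ) = (V (R i ξ η)).comp (m (R j ζ θ)) :=
    hext _ _ fun k κ μ => hrank i j k ξ η ζ θ κ μ
  have h2 (i ξ η p) : (V.flip p).comp (m (R i ξ η)) = (V (R i ξ η)).comp (m.flip p) :=
    hext _ _ fun j ζ θ => DFunLike.congr_fun (h1 i ξ η j ζ θ) p
  have h3 (b p) : (V.flip p).comp (m.flip b) = V.flip (b * p) :=
    hext _ _ fun i ξ η => DFunLike.congr_fun (h2 i ξ η p) b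
  exact DFunLike.congr_fun (h3 b p) a

end Bilinear

/-! ### Balanced bilinear maps on `c₀`-direct sums -/

section C0SumBilinear

variable {ι : Type*} {H : ι → Type*} [∀ i, NormedAddCommGroup (H i)]
  {B : ι → Type*} [∀ i, NonUnitalCStarAlgebra (B i)]

/-- A local-to-global principle for factorizations of `c` with prescribed properties: `p` on the
left factor in one component, `q` on the right factor in another, possibly the same, component. In
the remaining components any factorization of `c` will do. -/
theorem C0Sum.exists_mul_eq_of_forall_component {c : C0Sum B} (p q : ∀ i, H i → B i → Prop)
    (hloc : ∀ i (η ζ : H i), ∃ S T : B i, S * T = (c : lp B ∞) i ∧ p i ζ S ∧ q i η T)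
    (i j : ι) (η : H i) (ζ : H j) :
    ∃ a b : C0Sum B, a * b = c ∧ p j ζ ((a : lp B ∞) j) ∧ q i η ((b : lp B ∞) i) := by
  obtain ⟨a, b, hab⟩ := exists_mul_eq_of_nonUnitalCStarAlgebra c
  by_cases hij : j = i
  · subst hij
    obtain ⟨S, T, hST, hS, hT⟩ := hloc j η ζ
    obtain ⟨a', b', hab', rfl, rfl, -⟩ := C0Sum.exists_mul_eq_of_apply_mul_eq hab j hST
    exact ⟨a', b', hab', hS, hT⟩
  · obtain ⟨S, T, hST, -, hT⟩ := hloc i η 0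
    obtain ⟨S', T', hST', hS', -⟩ := hloc j 0 ζ
    obtain ⟨a₁, b₁, hab₁, -, rfl, -⟩ := C0Sum.exists_mul_eq_of_apply_mul_eq hab i hST
    obtain ⟨a₂, b₂, hab₂, rfl, -, h₂⟩ := C0Sum.exists_mul_eq_of_apply_mul_eq hab₁ j hST'
    exact ⟨a₂, b₂, hab₂, hS', by rwa [(h₂ i (Ne.symm hij)).2]⟩

/-- Let each summand be topologically spanned by elements `r i ξ η` that multiply like the rank-one
operators `ξ ⊗ η⋆`. A bounded bilinear map with product property at `c` is balanced if each component
of `c` has factorizations `S * T` in which `S` annihilates a prescribed `ζ` and the range of `T` is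
orthogonal to a prescribed `η`. -/
theorem C0Sum.map_mul_eq_of_hasProductPropertyAt [∀ i, InnerProductSpace ℂ (H i)]
    (r : ∀ i, H i →ₗ[ℂ] H i →ₗ⋆[ℂ] B i)
    (hmul : ∀ i ξ η ζ θ, r i ξ η * r i ζ θ = inner ℂ η ζ • r i ξ θ)
    (hdense : ∀ i, ∀ D : Submodule ℂ (B i), IsClosed (D : Set (B i)) →
      (∀ ξ η, r i ξ η ∈ D) → ∀ T, T ∈ D)
    {c : C0Sum B}
    (hloc : ∀ i (η ζ : H i), ∃ S T : B i, S * T = (c : lp B ∞) i ∧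
      (∀ θ, S * r i ζ θ = 0) ∧ ∀ ξ, r i ξ η * T = 0)
    {X : Type*} [NormedAddCommGroup X] [NormedSpace ℂ X] {V : C0Sum B →L[ℂ] C0Sum B →L[ℂ] X}
    (hV : HasProductPropertyAt V c) (a b p : C0Sum B) :
    V (a * b) p = V a (b * p) := by
  let R (i : ι) : H i →ₗ[ℂ] H i →ₗ⋆[ℂ] C0Sum B := (r i).compr₂ₛₗ (C0Sum.single i)
  have hR (i ξ η) : R i ξ η = C0Sum.single i (r i ξ η) := rfl
  refine map_mul_eq_of_rankOne R (fun i ξ η ζ θ => ?_) (fun i j hij ξ η ζ θ => ?_)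
    (fun D hD h => ?_) (fun i j ξ η ζ θ h => ?_) a b p
  · rw [hR, hR, C0Sum.mul_single, C0Sum.single_apply_same, hmul, map_smul, hR]
  · rw [hR, hR, C0Sum.mul_single, C0Sum.single_apply_of_ne hij.symm, zero_mul, map_zero]
  · refine eq_top_iff.2 fun x _ => C0Sum.mem_of_forall_single_mem hD (fun i T => ?_) x
    have hiso : Isometry (C0Sum.single (B := B) i) :=
      AddMonoidHomClass.isometry_of_norm _ (C0Sum.norm_single i)
    exact hdense i (D.comap (C0Sum.single i)) (hD.preimage hiso.continuous) (h i) T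
  · obtain ⟨a, b, hab, ha, hb⟩ := C0Sum.exists_mul_eq_of_forall_component
      (fun i ζ S => ∀ θ, S * r i ζ θ = 0) (fun i η T => ∀ ξ, r i ξ η * T = 0) hloc i j η ζ
    refine hV.map_eq_zero hab ?_ ?_ h
    · rw [hR, C0Sum.single_mul, hb, map_zero]
    · rw [hR, C0Sum.mul_single, ha, map_zero]

end C0SumBilinear

/-! ### Compact C⋆-algebras and the rank hypothesis -/

section CompactCStarAlgebra

variable {ι : Type u} {H : ι → Type v} [∀ i, NormedAddCommGroup (H i)]
  [∀ i, InnerProductSpace ℂ (H i)] [∀ i, CompleteSpace (H i)]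

theorem RankHypothesis.map_mul_eq {c : CompactCStarAlgebra H} (hc : RankHypothesis c)
    {X : Type*} [NormedAddCommGroup X] [NormedSpace ℂ X]
    {V : CompactCStarAlgebra H →L[ℂ] CompactCStarAlgebra H →L[ℂ] X}
    (hV : HasProductPropertyAt V c) (a b p : CompactCStarAlgebra H) :
    V (a * b) p = V a (b * p) := by
  refine C0Sum.map_mul_eq_of_hasProductPropertyAt (fun i => CompactOperators.rankOne (H i))
    (fun i => CompactOperators.rankOne_mul_rankOne)
    (fun i D => CompactOperators.mem_of_forall_rankOne_mem) (fun i η ζ => ?_) hV a b p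
  obtain ⟨S, T, hST, hS, hT⟩ := CompactOperators.exists_mul_eq
    ((c : lp (fun i => CompactOperators (H i)) ∞) i) (hc i) η ζ
  refine ⟨S, T, hST, fun θ => ?_, fun ξ => ?_⟩
  · rw [CompactOperators.mul_rankOne, hS, map_zero, LinearMap.zero_apply]
  · rw [CompactOperators.rankOne_mul, hT, map_zero]

/-- The rank hypothesis is automatic if all summands are infinite-dimensional. -/
theorem RankHypothesis.of_not_finiteDimensional
    (h : ∀ i, ¬ FiniteDimensional ℂ (CompactOperators (H i))) (c : CompactCStarAlgebra H) :
    RankHypothesis c := by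
  intro i
  have hi : ¬ FiniteDimensional ℂ (H i) := fun hfin => h i <|
    FiniteDimensional.finiteDimensional_submodule (CompactOperators (H i)).toSubmodule
  have htop : Cardinal.toENat (Module.rank ℂ (H i)) = ⊤ := by
    rw [Cardinal.toENat_eq_top]
    exact not_lt.1 fun hlt => hi (Module.rank_lt_aleph0_iff.1 hlt)
  rw [htop]
  exact le_top

end CompactCStarAlgebra

theorem mainTheorem1 {ι : Type u} (H : ι → Type v) [∀ i, NormedAddCommGroup (H i)]
    [∀ i, InnerProductSpace ℂ (H i)] [∀ i, CompleteSpace (H i)] :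
    (∀ c : CompactCStarAlgebra H, RankHypothesis c →
      IsDeterminedByProductsAt.{max u v, w} (CompactCStarAlgebra H) c) ∧
    ((∀ i, ¬ FiniteDimensional ℂ (CompactOperators (H i))) →
      ∀ c : CompactCStarAlgebra H,
        IsDeterminedByProductsAt.{max u v, w} (CompactCStarAlgebra H) c) := by
  have hmain (c : CompactCStarAlgebra H) (hc : RankHypothesis c) :
      IsDeterminedByProductsAt.{max u v, w} (CompactCStarAlgebra H) c := by
    intro X _ _ _ V hV
    exact hasProductProperty_of_map_mul_eq V (hc.map_mul_eq hV)
  exact ⟨hmain, fun h c => hmain c (.of_not_finiteDimensional h c)⟩
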